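/- Let $N\in\mathbb N$ and $1<p<N$. A domain is a nonempty connected open set. A domain $\Omega\subset\mathbb R^N$ has $C^1$ boundary (in particular, this holds if its boundary is smooth) if every $x\in\partial\Omega$ has an open neighbourhood $U$ with $\Omega\cap U=\{y\in U:\rho(y)<0\}$ for some $\rho\in C^1(U)$ with $\nabla\rho(x)\neq0$. Let $r_\Omega=\sup_{x\in\Omega}d(x,\mathbb R^N\setminus\Omega)\in(0,\infty]$ be the inner radius of $\Omega$. For $K$ compact and $U\supset K$ open let $$\mathrm{cap}_p(K,U)=\inf\Big\{\int_U|\nabla\varphi|^p\,dx:\ \varphi\in C_c^\infty(U),\ \varphi\ge1\text{ on }K\Big\}.$$ For $\kappa>0$, say that the complement of $\Omega$ has $p$-capacity density at least $\kappa$ if $$\mathrm{cap}_p\big((\mathbb R^N\setminus\Omega)\cap\overline B(x,r),\,B(x,2r)\big)\ \ge\ \kappa\, r^{N-p}\qquad\text{for all }x\in\mathbb R^N\setminus\Omega\text{ and all }r>0 .$$ **Theorem 2.4.** (a) For every $\kappa>0$ there is a constant $C>0$, depending only on $p$, $N$ and $\kappa$, such that the following holds. Let $\Omega\subset\mathbb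 R^N$ be a domain with $C^1$ boundary whose complement has $p$-capacity density at least $\kappa$, let $N/p<s<\infty$, and let $w\in L^s(\Omega)$ be real-valued (of any sign). If $u\in W_0^{1,p}(\Omega)$ (the closure of $C_c^\infty(\Omega)$ in $W^{1,p}(\Omega)$) is a nontrivial weak solution of $$-\Delta_p u=w|u|^{p-2}u\ \text{ in }\Omega,\qquad u=0\ \text{ on }\partial\Omega,$$ that is, $\int_\Omega|\nabla u|^{p-2}\nabla u\cdot\nabla\varphi\,dx=\int_\Omega w|u|^{p-2}u\varphi\,dx$ for all $\varphi\in W_0^{1,p}(\Omega)$, then $$\frac{C}{r_\Omega^{(sp-N)/s}}\ \le\ \|w\|_{L^s(\Omega)},$$ where the left-hand side is read as $0$ if $r_\Omega=\infty$. (b) For every bounded domain $\Omega\subset\mathbb R^N$ with $C^1$ boundary, the complement of $\Omega$ has $p$-capacity density at least $\kappa$ for some $\kappa>0$. Hence the inequality in (a) holds in every such domain. -/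

import Mathlib

open MeasureTheory Filter Topology
open scoped ENNReal ContDiff

namespace Lyapunov

/-- Euclidean space `ℝ^N`. -/
abbrev Space (N : ℕ) : Type := EuclideanSpace ℝ (Fin N)

/-- The `ℝ^N`-valued function `G` is the weak (distributional) gradient of `u` in `Ω`. -/
def IsWeakGradient {N : ℕ} (Ω : Set (Space N)) (u : Space N → ℝ) (G : Space N → Space N) : Prop :=
  LocallyIntegrableOn u Ω ∧ LocallyIntegrableOn G Ω ∧
    ∀ φ : Space N → ℝ, ContDiff ℝ ∞ φ → HasCompactSupport φ → tsupport φ ⊆ Ω →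
      ∀ v : Space N,
        ∫ x in Ω, u x * inner ℝ (gradient φ x) v = -∫ x in Ω, inner ℝ (G x) v * φ x

/-- `u ∈ W^{1,p}(Ω)`, with weak gradient `G`. Functions are defined on all of `ℝ^N`, but only
their values on `Ω` matter. -/
structure MemW1 {N : ℕ} (p : ℝ) (Ω : Set (Space N)) (u : Space N → ℝ) (G : Space N → Space N) :
    Prop where
  memLp : MemLp u (ENNReal.ofReal p) (volume.restrict Ω)
  memLp_grad : MemLp G (ENNReal.ofReal p) (volume.restrict Ω)
  isWeakGradient : IsWeakGradient Ω u G

/-- `u ∈ W₀^{1,p}(Ω)`, with weak gradient `G`: `u` belongs to the closure of `C_c^∞(Ω)` in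
`W^{1,p}(Ω)`. -/
def MemW10 {N : ℕ} (p : ℝ) (Ω : Set (Space N)) (u : Space N → ℝ) (G : Space N → Space N) :
    Prop :=
  MemW1 p Ω u G ∧
    ∃ φ : ℕ → Space N → ℝ,
      (∀ n, ContDiff ℝ ∞ (φ n) ∧ HasCompactSupport (φ n) ∧ tsupport (φ n) ⊆ Ω) ∧
      Tendsto (fun n => eLpNorm (fun x => φ n x - u x) (ENNReal.ofReal p) (volume.restrict Ω))
        atTop (𝓝 0) ∧
      Tendsto (fun n => eLpNorm (fun x => gradient (φ n) x - G x) (ENNReal.ofReal p)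
        (volume.restrict Ω)) atTop (𝓝 0)

/-- `u ∈ W₀^{1,p}(Ω)` is a weak solution of `-Δ_p u = w |u|^{p-2} u` in `Ω`, `u = 0` on `∂Ω`:
`∫_Ω |∇u|^{p-2} ∇u · ∇φ = ∫_Ω w |u|^{p-2} u φ` for all `φ ∈ W₀^{1,p}(Ω)`. -/
def IsDirichletSolution {N : ℕ} (p : ℝ) (Ω : Set (Space N)) (w u : Space N → ℝ) : Prop :=
  ∃ G : Space N → Space N, MemW10 p Ω u G ∧
    ∀ (φ : Space N → ℝ) (Φ : Space N → Space N), MemW10 p Ω φ Φ →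
      ∫ x in Ω, ‖G x‖ ^ (p - 2) * inner ℝ (G x) (Φ x) =
        ∫ x in Ω, w x * |u x| ^ (p - 2) * u x * φ x

/-- A domain (nonempty connected open set) with `C¹` boundary: near each boundary point it is
the sublevel set `{ρ < 0}` of a `C¹` function whose derivative does not vanish there. -/
structure IsC1Domain {N : ℕ} (Ω : Set (Space N)) : Prop where
  isOpen : IsOpen Ω
  isConnected : IsConnected Ω
  boundary : ∀ x ∈ frontier Ω, ∃ (U : Set (Space N)) (ρ : Space N → ℝ),
    IsOpen U ∧ x ∈ U ∧ ContDiffOn ℝ 1 ρ U ∧ fderiv ℝ ρ x ≠ 0 ∧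
      Ω ∩ U = {y | ρ y < 0} ∩ U

/-- The inner radius `r_Ω = sup_{x ∈ Ω} d(x, Ωᶜ)`, possibly `∞`. -/
noncomputable def innerRadius {N : ℕ} (Ω : Set (Space N)) : ℝ≥0∞ :=
  ⨆ x ∈ Ω, Metric.infEDist x Ωᶜ

/-- The variational `p`-capacity `cap_p(K, U)` of a compact set `K` relative to an open set `U`:
the infimum of `∫_U |∇φ|^p` over all `φ ∈ C_c^∞(U)` with `φ ≥ 1` on `K`. -/
noncomputable def pCapacity {N : ℕ} (p : ℝ) (K U : Set (Space N)) : ℝ≥0∞ :=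
  ⨅ φ ∈ {φ : Space N → ℝ | ContDiff ℝ ∞ φ ∧ HasCompactSupport φ ∧ tsupport φ ⊆ U ∧
      ∀ x ∈ K, 1 ≤ φ x},
    ∫⁻ x in U, ‖gradient φ x‖ₑ ^ p

/-- The closed set `E` is uniformly `p`-fat with constant `κ` (capacity density condition):
`cap_p(E ∩ B̄(x, r), B(x, 2r)) ≥ κ r^{N-p}` for all `x ∈ E` and `r > 0`. -/
def IsUniformlyFat {N : ℕ} (p κ : ℝ) (E : Set (Space N)) : Prop :=
  ∀ x ∈ E, ∀ r : ℝ, 0 < r →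
    ENNReal.ofReal (κ * r ^ ((N : ℝ) - p)) ≤
      pCapacity p (E ∩ Metric.closedBall x r) (Metric.ball x (2 * r))

end Lyapunov

namespace Lyapunov

/-! For (a), testing the equation with `u` gives `∫|∇u|^p = ∫ w|u|^p`. Hölder and interpolation
between `L^p` and `L^{p*}`, `p* = Np/(N-p)`, bound the right side by `‖w‖_s ‖u‖_p^{(sp-N)/s}
‖u‖_{p*}^{N/s}`. The Sobolev inequality `‖u‖_{p*} ≤ M‖∇u‖_p` and the Poincaré inequality `‖u‖_p ≤ M
r_Ω ‖∇u‖_p` turn this into `‖∇u‖_p^p ≤ ‖w‖_s M^p r_Ω^{(sp-N)/s} ‖∇u‖_p^p`, and `‖∇u‖_p` cancels.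

The heart is the Poincaré inequality (`exists_poincare_innerRadius`), where fatness enters. A test
function `φ` on a ball is close in `L^p` to some constant `m`. Since `φ` vanishes on the fat
complement, `η(1 - φ/m)` is admissible for the capacity, which bounds `|m|` by the energy
(`exists_capacity_poincare`). Every point of `Ω` is within about `r_Ω` of the complement, so this
local estimate holds around every point, and averaging over centres makes it global.

For (b), the Sobolev inequality gives `cap_p(K, U) ≥ c|K|^{(N-p)/N}`, so it suffices that the
complement contains, near each of its points and at every scale `r`, a ball of radius `a r`
(`IsC1Domain.exists_corkscrew`). At small scales this follows from the `C¹` boundary and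
compactness, at large scales from boundedness of `Ω`. -/

theorem enorm_gradient {N : ℕ} (φ : Space N → ℝ) (x : Space N) :
    ‖gradient φ x‖ₑ = ‖fderiv ℝ φ x‖ₑ := by
  rw [← toDual_gradient, LinearIsometryEquiv.enorm_map]

/-! ### Poincaré inequality on convex sets -/

/-- Jensen's inequality for powers on a probability space. -/
theorem lintegral_rpow_le_of_isProbabilityMeasure {α : Type*} [MeasurableSpace α]
    (μ : Measure α) [IsProbabilityMeasure μ] {p : ℝ} (hp : 1 ≤ p) {f : α → ℝ≥0∞}
    (hf : AEMeasurable f μ) : (∫⁻ x, f x ∂μ) ^ p ≤ ∫⁻ x, f x ^ p ∂μ := by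
  have hp0 : 0 < p := by linarith
  have h := eLpNorm'_le_eLpNorm'_of_exponent_le (f := f) zero_lt_one hp μ
    hf.aestronglyMeasurable
  simp only [eLpNorm', enorm_eq_self, ENNReal.rpow_one, div_one] at h
  calc (∫⁻ x, f x ∂μ) ^ p ≤ ((∫⁻ x, f x ^ p ∂μ) ^ (1 / p)) ^ p := by gcongr
    _ = ∫⁻ x, f x ^ p ∂μ := by
      rw [← ENNReal.rpow_mul, one_div, inv_mul_cancel₀ hp0.ne', ENNReal.rpow_one]

/-- The fundamental theorem of calculus along the segment, followed by Jensen in `t`. -/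
theorem enorm_sub_rpow_le_lintegral_segment {N : ℕ} {p : ℝ} (hp : 1 ≤ p) {φ : Space N → ℝ}
    (hφ : ContDiff ℝ 1 φ) (x y : Space N) :
    ‖φ x - φ y‖ₑ ^ p ≤
      ‖x - y‖ₑ ^ p * ∫⁻ t in Set.Icc (0 : ℝ) 1, ‖fderiv ℝ φ (y + t • (x - y))‖ₑ ^ p := by
  have hp0 : 0 < p := by linarith
  have hc : Continuous (fderiv ℝ φ) := hφ.continuous_fderiv (by norm_num)
  have hline : ∀ t : ℝ, HasDerivAt (fun t : ℝ => y + t • (x - y)) (x - y) t := fun t => by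
    simpa using ((hasDerivAt_id t).smul_const (x - y)).const_add y
  have hder : ∀ t : ℝ, HasDerivAt (fun t : ℝ => φ (y + t • (x - y)))
      (fderiv ℝ φ (y + t • (x - y)) (x - y)) t := fun t =>
    ((hφ.differentiable (by norm_num)) _).hasFDerivAt.comp_hasDerivAt t (hline t)
  have h1 := enorm_sub_le_lintegral_deriv_of_contDiffOn_Icc
    (f := fun t : ℝ => φ (y + t • (x - y))) (a := 0) (b := 1)
    (hφ.comp (by fun_prop)).contDiffOn zero_le_one
  simp only [one_smul, zero_smul, add_zero, add_sub_cancel] at h1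
  have : IsProbabilityMeasure (volume.restrict (Set.Icc (0 : ℝ) 1)) := ⟨by simp⟩
  have hm : Measurable fun t : ℝ => ‖fderiv ℝ φ (y + t • (x - y))‖ₑ :=
    (hc.comp (by fun_prop)).enorm.measurable
  calc ‖φ x - φ y‖ₑ ^ p
      ≤ (∫⁻ t in Set.Icc (0 : ℝ) 1, ‖x - y‖ₑ * ‖fderiv ℝ φ (y + t • (x - y))‖ₑ) ^ p := by
        gcongr
        refine h1.trans (lintegral_mono fun t => ?_)
        rw [(hder t).deriv, mul_comm]
        exact ContinuousLinearMap.le_opENorm _ _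
    _ ≤ ∫⁻ t in Set.Icc (0 : ℝ) 1, (‖x - y‖ₑ * ‖fderiv ℝ φ (y + t • (x - y))‖ₑ) ^ p :=
        lintegral_rpow_le_of_isProbabilityMeasure _ hp (hm.const_mul _).aemeasurable
    _ = _ := by
        simp_rw [ENNReal.mul_rpow_of_nonneg _ _ hp0.le]
        rw [lintegral_const_mul _ (hm.pow_const p)]

/-- The substitution has Jacobian `t^N`, and `t ≥ 1/2` keeps its inverse below `2^N`. -/
theorem lintegral_add_smul_le {N : ℕ} {g : Space N → ℝ≥0∞} (hg : Measurable g) (z : Space N)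
    {t : ℝ} (ht : 1 / 2 ≤ t) :
    ∫⁻ x, g (z + t • x) ≤ 2 ^ N * ∫⁻ x, g x := by
  have ht0 : 0 < t := by linarith
  have hg' : Measurable fun x => g (z + x) := hg.comp (measurable_const_add z)
  have h := Measure.map_addHaar_smul (volume : Measure (Space N)) ht0.ne'
  calc ∫⁻ x, g (z + t • x) = ∫⁻ x, g (z + x) ∂(Measure.map (t • ·) volume) := by
        rw [lintegral_map hg' (measurable_const_smul t)]
    _ = ENNReal.ofReal |(t ^ N)⁻¹| * ∫⁻ x, g x := by
        rw [h, lintegral_smul_measure, lintegral_add_left_eq_self]; simp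
    _ ≤ _ := by
        gcongr
        rw [abs_of_pos (by positivity), ← inv_pow, ENNReal.ofReal_pow (by positivity)]
        gcongr
        calc ENNReal.ofReal t⁻¹ ≤ ENNReal.ofReal 2 := by
              apply ENNReal.ofReal_le_ofReal
              rw [inv_le_comm₀ ht0 (by norm_num)]; linarith
          _ = 2 := by simp

/-- By convexity the image point stays in `B`, so the substitution can be applied to `g` cut off to
`B`. -/
theorem setLIntegral_add_smul_le {N : ℕ} {g : Space N → ℝ≥0∞} (hg : Measurable g)
    {B : Set (Space N)} (hB : MeasurableSet B) (hconv : Convex ℝ B) {t : ℝ} (ht : 1 / 2 ≤ t)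
    (ht1 : t ≤ 1) {y : Space N} (hy : y ∈ B) :
    ∫⁻ x in B, g (y + t • (x - y)) ≤ 2 ^ N * ∫⁻ x in B, g x := by
  rw [← lintegral_indicator hB, ← lintegral_indicator hB]
  refine le_trans (lintegral_mono fun x => ?_)
    (lintegral_add_smul_le (hg.indicator hB) (y - t • y) ht)
  have e : y - t • y + t • x = y + t • (x - y) := by module
  rw [e]
  by_cases hx : x ∈ B
  · have := hconv.add_smul_sub_mem hy hx ⟨by linarith, ht1⟩
    simp [hx, this]
  · simp [hx]

/-- One of `t` and `1 - t` is at least `1/2`, so the change of variables is harmless in `x` or in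
`y`; this avoids a singular Jacobian as `t → 0`. -/
theorem lintegral_lintegral_segment_le {N : ℕ} {g : Space N → ℝ≥0∞} (hg : Measurable g)
    {B : Set (Space N)} (hB : MeasurableSet B) (hconv : Convex ℝ B) {t : ℝ} (ht0 : 0 ≤ t)
    (ht1 : t ≤ 1) :
    ∫⁻ y in B, ∫⁻ x in B, g (y + t • (x - y)) ≤ volume B * (2 ^ N * ∫⁻ x in B, g x) := by
  rcases le_total (1 / 2) t with ht | ht
  · calc _ ≤ ∫⁻ y in B, 2 ^ N * ∫⁻ x in B, g x :=
          setLIntegral_mono' hB fun y hy => setLIntegral_add_smul_le hg hB hconv ht ht1 hy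
      _ = _ := by simp [mul_comm]
  · rw [lintegral_lintegral_swap (by fun_prop)]
    calc _ ≤ ∫⁻ x in B, 2 ^ N * ∫⁻ y in B, g y := by
          refine setLIntegral_mono' hB fun x hx => ?_
          have := setLIntegral_add_smul_le hg hB hconv (t := 1 - t) (by linarith) (by linarith) hx
          convert this using 3
          congr 1
          module
      _ = _ := by simp [mul_comm]

/-- Tonelli brings `t` outermost, because the variable to substitute depends on `t`. -/
theorem lintegral_segment_swap {N : ℕ} {g : Space N → ℝ≥0∞} (hg : Measurable g)
    (μ : Measure (Space N)) [SFinite μ] (ν : Measure ℝ) [SFinite ν] (a : ℝ≥0∞) :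
    ∫⁻ y, ∫⁻ x, a * ∫⁻ t, g (y + t • (x - y)) ∂ν ∂μ ∂μ =
      a * ∫⁻ t, ∫⁻ y, ∫⁻ x, g (y + t • (x - y)) ∂μ ∂μ ∂ν := by
  have hm3 : Measurable fun q : (Space N × Space N) × ℝ => g (q.1.1 + q.2 • (q.1.2 - q.1.1)) := by
    fun_prop
  have hm2 : Measurable fun q : Space N × Space N => ∫⁻ t, g (q.1 + t • (q.2 - q.1)) ∂ν :=
    hm3.lintegral_prod_right'
  have hm1 : Measurable fun y : Space N => ∫⁻ x, ∫⁻ t, g (y + t • (x - y)) ∂ν ∂μ :=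
    hm2.lintegral_prod_right'
  have hm4 : Measurable fun q : (Space N × ℝ) × Space N => g (q.1.1 + q.1.2 • (q.2 - q.1.1)) := by
    fun_prop
  calc _ = ∫⁻ y, a * ∫⁻ x, ∫⁻ t, g (y + t • (x - y)) ∂ν ∂μ ∂μ :=
        lintegral_congr fun y => lintegral_const_mul _ (hm2.comp measurable_prodMk_left)
    _ = a * ∫⁻ y, ∫⁻ x, ∫⁻ t, g (y + t • (x - y)) ∂ν ∂μ ∂μ := lintegral_const_mul _ hm1
    _ = a * ∫⁻ y, ∫⁻ t, ∫⁻ x, g (y + t • (x - y)) ∂μ ∂ν ∂μ := by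
        congr 1
        exact lintegral_congr fun y => lintegral_lintegral_swap
          (hm3.comp (measurable_prodMk_left.prodMap measurable_id)).aemeasurable
    _ = _ := by
        congr 1
        exact lintegral_lintegral_swap hm4.lintegral_prod_right'.aemeasurable

/-- A Poincaré inequality on a bounded convex set, in double integral form. -/
theorem lintegral_lintegral_enorm_sub_rpow_le {N : ℕ} {p : ℝ} (hp : 1 ≤ p) {φ : Space N → ℝ}
    (hφ : ContDiff ℝ 1 φ) {B : Set (Space N)} (hB : MeasurableSet B) (hconv : Convex ℝ B)
    {D : ℝ≥0∞} (hD : ∀ x ∈ B, ∀ y ∈ B, ‖x - y‖ₑ ≤ D) :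
    ∫⁻ y in B, ∫⁻ x in B, ‖φ x - φ y‖ₑ ^ p ≤
      volume B * (2 ^ N * D ^ p * ∫⁻ x in B, ‖fderiv ℝ φ x‖ₑ ^ p) := by
  have hc : Continuous (fderiv ℝ φ) := hφ.continuous_fderiv (by norm_num)
  obtain ⟨g, hgdef⟩ : ∃ g : Space N → ℝ≥0∞, g = fun x => ‖fderiv ℝ φ x‖ₑ ^ p := ⟨_, rfl⟩
  have hg : Measurable g := hgdef ▸ hc.enorm.measurable.pow_const p
  have hgx : ∀ x, ‖fderiv ℝ φ x‖ₑ ^ p = g x := fun x => by rw [hgdef]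
  have hp0 : 0 < p := by linarith
  simp_rw [hgx]
  calc ∫⁻ y in B, ∫⁻ x in B, ‖φ x - φ y‖ₑ ^ p
      ≤ ∫⁻ y in B, ∫⁻ x in B, D ^ p * ∫⁻ t in Set.Icc (0 : ℝ) 1, g (y + t • (x - y)) := by
        refine setLIntegral_mono' hB fun y hy => setLIntegral_mono' hB fun x hx => ?_
        refine (enorm_sub_rpow_le_lintegral_segment hp hφ x y).trans ?_
        simp_rw [hgx]
        gcongr
        exact hD x hx y hy
    _ = D ^ p * ∫⁻ t in Set.Icc (0 : ℝ) 1, ∫⁻ y in B, ∫⁻ x in B, g (y + t • (x - y)) :=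
        lintegral_segment_swap hg _ _ _
    _ ≤ D ^ p * ∫⁻ t in Set.Icc (0 : ℝ) 1, volume B * (2 ^ N * ∫⁻ x in B, g x) :=
        mul_le_mul_right (setLIntegral_mono' measurableSet_Icc fun t ht =>
          lintegral_lintegral_segment_le hg hB hconv ht.1 ht.2) _
    _ = _ := by
        rw [setLIntegral_const, Real.volume_Icc]
        simp only [sub_zero, ENNReal.ofReal_one, mul_one]
        ring

/-- A Poincaré inequality on a ball, where the mean is replaced by a suitable value. -/
theorem exists_lintegral_enorm_sub_rpow_le {N : ℕ} {p : ℝ} (hp : 1 ≤ p) {φ : Space N → ℝ}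
    (hφ : ContDiff ℝ 1 φ) (c : Space N) {R : ℝ} (hR : 0 < R) :
    ∃ m : ℝ, ∫⁻ x in Metric.ball c R, ‖φ x - m‖ₑ ^ p ≤
      2 ^ N * ENNReal.ofReal (2 * R) ^ p *
        ∫⁻ x in Metric.ball c R, ‖fderiv ℝ φ x‖ₑ ^ p := by
  have h := lintegral_lintegral_enorm_sub_rpow_le hp hφ (B := Metric.ball c R)
    measurableSet_ball (convex_ball c R) (D := ENNReal.ofReal (2 * R)) (by
      intro x hx y hy
      rw [← ofReal_norm]
      apply ENNReal.ofReal_le_ofReal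
      rw [← dist_eq_norm]
      have := dist_triangle_right x y c
      rw [Metric.mem_ball] at hx hy
      linarith)
  have hv0 : volume (Metric.ball c R) ≠ 0 := (Metric.measure_ball_pos _ _ hR).ne'
  have hv1 : volume (Metric.ball c R) ≠ ⊤ := measure_ball_lt_top.ne
  have hφc := hφ.continuous
  -- Some `y` does no worse than the average over the ball; `m = φ y` then replaces the mean.
  obtain ⟨y, -, hy⟩ := exists_le_setLAverage (μ := volume) (s := Metric.ball c R)
    (f := fun y => ∫⁻ x in Metric.ball c R, ‖φ x - φ y‖ₑ ^ p) hv0 hv1 (by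
      have : Measurable fun q : Space N × Space N => ‖φ q.2 - φ q.1‖ₑ ^ p := by
        have : Continuous fun q : Space N × Space N => φ q.2 - φ q.1 := by fun_prop
        exact this.enorm.measurable.pow_const p
      exact this.lintegral_prod_right'.aemeasurable)
  refine ⟨φ y, hy.trans ?_⟩
  rw [setLAverage_eq, ENNReal.div_le_iff hv0 hv1, mul_comm]
  convert h using 1

/-! ### Capacitary Poincaré inequality on a ball -/

/-- Cutoff functions between concentric balls with the natural gradient bound. -/
theorem exists_cutoff (N : ℕ) :
    ∃ L : ℝ, ∀ (y : Space N) (ρ : ℝ), 0 < ρ → ∃ η : Space N → ℝ, ContDiff ℝ ∞ η ∧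
      HasCompactSupport η ∧ tsupport η ⊆ Metric.ball y (2 * ρ) ∧
      (∀ x ∈ Metric.closedBall y ρ, η x = 1) ∧ (∀ x, |η x| ≤ 1) ∧
      ∀ x, ‖fderiv ℝ η x‖ ≤ L / ρ := by
  -- The outer radius `3/2 < 2` leaves room for the closed support inside the open ball of radius
  -- `2ρ`.
  let f : ContDiffBump (0 : Space N) := ⟨1, 3 / 2, by norm_num, by norm_num⟩
  have hf : ContDiff ℝ ∞ f := f.contDiff
  obtain ⟨L, hL⟩ := (f.hasCompactSupport.fderiv (𝕜 := ℝ)).exists_bound_of_continuous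
    (hf.continuous_fderiv (by simp))
  refine ⟨L, fun y ρ hρ => ?_⟩
  have hs : Function.support (fun x => f (ρ⁻¹ • (x - y))) ⊆ Metric.closedBall y (3 / 2 * ρ) := by
    intro x hx
    have h1 : ρ⁻¹ • (x - y) ∈ Function.support f := hx
    rw [f.support_eq, mem_ball_zero_iff, norm_smul, norm_inv, Real.norm_of_nonneg hρ.le] at h1
    rw [mem_closedBall_iff_norm]
    have h2 : ρ⁻¹ * ‖x - y‖ < 3 / 2 := h1
    rw [inv_mul_lt_iff₀ hρ] at h2
    linarith
  have hts : tsupport (fun x => f (ρ⁻¹ • (x - y))) ⊆ Metric.closedBall y (3 / 2 * ρ) :=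
    closure_minimal hs Metric.isClosed_closedBall
  refine ⟨fun x => f (ρ⁻¹ • (x - y)), hf.comp (by fun_prop),
    HasCompactSupport.intro' (isCompact_closedBall y (3 / 2 * ρ)) Metric.isClosed_closedBall
      fun x hx => Function.notMem_support.mp fun h => hx (hs h),
    hts.trans (Metric.closedBall_subset_ball (by linarith)), fun x hx => ?_, fun x => ?_,
    fun x => ?_⟩
  · refine f.one_of_mem_closedBall ?_
    rw [mem_closedBall_iff_norm] at hx
    rw [mem_closedBall_zero_iff, norm_smul, norm_inv, Real.norm_of_nonneg hρ.le]
    change ρ⁻¹ * ‖x - y‖ ≤ 1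
    rw [inv_mul_le_iff₀ hρ]
    linarith
  · rw [abs_of_nonneg f.nonneg]
    exact f.le_one
  · have h1 : HasFDerivAt (fun x => ρ⁻¹ • (x - y)) (ρ⁻¹ • ContinuousLinearMap.id ℝ (Space N)) x :=
      ((hasFDerivAt_id x).sub_const y).const_smul ρ⁻¹
    have h2 := ((hf.differentiable (by simp)) (ρ⁻¹ • (x - y))).hasFDerivAt.comp x h1
    have h3 : fderiv ℝ (fun x => f (ρ⁻¹ • (x - y))) x = ρ⁻¹ • fderiv ℝ f (ρ⁻¹ • (x - y)) := by
      rw [show (fun x => f (ρ⁻¹ • (x - y))) = f ∘ fun x => ρ⁻¹ • (x - y) from rfl, h2.fderiv]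
      ext v
      simp
    rw [h3, norm_smul, norm_inv, Real.norm_of_nonneg hρ.le, div_eq_inv_mul]
    exact mul_le_mul_of_nonneg_left (hL _) (by positivity)

/-- The product rule and `(a + b)^p ≤ 2^{p-1}(a^p + b^p)`. It bounds the energy of the competitor
for the capacity, multiplied by `m` to avoid a division. -/
theorem lintegral_cutoff_le {N : ℕ} {p : ℝ} (hp : 1 ≤ p) {φ η : Space N → ℝ}
    (hφ : ContDiff ℝ 1 φ) (hη : ContDiff ℝ 1 η) (hη1 : ∀ x, |η x| ≤ 1) {ℓ : ℝ}
    (hηd : ∀ x, ‖fderiv ℝ η x‖ ≤ ℓ) (m : ℝ) (B : Set (Space N)) :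
    ∫⁻ x in B, ‖fderiv ℝ (fun x => η x * (m - φ x)) x‖ₑ ^ p ≤
      2 ^ (p - 1) * (ENNReal.ofReal ℓ ^ p * (∫⁻ x in B, ‖φ x - m‖ₑ ^ p) +
        ∫⁻ x in B, ‖fderiv ℝ φ x‖ₑ ^ p) := by
  have hp0 : 0 ≤ p := by linarith
  have hm1 : Measurable fun x => ‖φ x - m‖ₑ ^ p :=
    (hφ.continuous.sub continuous_const).enorm.measurable.pow_const p
  have hm2 : Measurable fun x => ‖fderiv ℝ φ x‖ₑ ^ p :=
    (hφ.continuous_fderiv (by norm_num)).enorm.measurable.pow_const p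
  calc _ ≤ ∫⁻ x in B, 2 ^ (p - 1) * (ENNReal.ofReal ℓ ^ p * ‖φ x - m‖ₑ ^ p +
        ‖fderiv ℝ φ x‖ₑ ^ p) := by
        refine lintegral_mono fun x => ?_
        have h1 : HasFDerivAt (fun x => η x * (m - φ x))
            (η x • (-fderiv ℝ φ x) + (m - φ x) • fderiv ℝ η x) x :=
          ((hη.differentiable (by norm_num)) x).hasFDerivAt.mul
            (((hφ.differentiable (by norm_num)) x).hasFDerivAt.const_sub m)
        have h2 : ‖fderiv ℝ (fun x => η x * (m - φ x)) x‖ₑ ≤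
            ENNReal.ofReal ℓ * ‖φ x - m‖ₑ + ‖fderiv ℝ φ x‖ₑ := by
          rw [h1.fderiv, add_comm (ENNReal.ofReal ℓ * _)]
          refine (enorm_add_le (E := Space N →L[ℝ] ℝ) _ _).trans (add_le_add ?_ ?_)
          · rw [enorm_smul, enorm_neg]
            refine mul_le_of_le_one_left' ?_
            rw [← ofReal_norm, ← ENNReal.ofReal_one]
            exact ENNReal.ofReal_le_ofReal (hη1 x)
          · rw [enorm_smul, mul_comm, ← neg_sub, enorm_neg, ← ofReal_norm (fderiv ℝ η x)]
            gcongr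
            exact hηd x
        calc _ ≤ (ENNReal.ofReal ℓ * ‖φ x - m‖ₑ + ‖fderiv ℝ φ x‖ₑ) ^ p := by gcongr
          _ ≤ _ := by
            refine (ENNReal.rpow_add_le_mul_rpow_add_rpow _ _ hp).trans ?_
            rw [ENNReal.mul_rpow_of_nonneg _ _ hp0]
    _ = _ := by
        rw [lintegral_const_mul _ (by fun_prop), lintegral_add_left (by fun_prop),
          lintegral_const_mul _ hm1]

/-- Testing the capacity with `η (1 - φ / m)`. -/
theorem enorm_rpow_mul_pCapacity_le {N : ℕ} {p : ℝ} (hp : 0 < p) {φ η : Space N → ℝ}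
    (hφ : ContDiff ℝ ∞ φ) (hη : ContDiff ℝ ∞ η) (hηc : HasCompactSupport η)
    {U K : Set (Space N)} (hU : tsupport η ⊆ U) (hηK : ∀ x ∈ K, η x = 1)
    (hφK : ∀ x ∈ K, φ x = 0) (m : ℝ) :
    ‖m‖ₑ ^ p * pCapacity p K U ≤ ∫⁻ x in U, ‖fderiv ℝ (fun x => η x * (m - φ x)) x‖ₑ ^ p := by
  rcases eq_or_ne m 0 with rfl | hm
  · simp [hp]
  have hχ : ContDiff ℝ ∞ fun x => η x * (m - φ x) := hη.mul (contDiff_const.sub hφ)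
  have hcap : pCapacity p K U ≤
      ∫⁻ x in U, ‖gradient (fun x => m⁻¹ * (η x * (m - φ x))) x‖ₑ ^ p := by
    refine iInf₂_le _ ⟨contDiff_const.mul hχ, ?_, ?_, ?_⟩
    · exact HasCompactSupport.mul_left (f := fun _ => m⁻¹) hηc.mul_right
    · refine subset_trans ?_ hU
      refine closure_mono fun x hx => ?_
      simp only [Function.mem_support, ne_eq, mul_eq_zero, not_or] at hx ⊢
      exact hx.2.1
    · intro x hx
      simp [hηK x hx, hφK x hx, hm]
  have hmul : ‖m‖ₑ * ‖m⁻¹‖ₑ = 1 := by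
    rw [← enorm_mul, mul_inv_cancel₀ hm, enorm_one]
  calc _ ≤ ‖m‖ₑ ^ p * ∫⁻ x in U, ‖gradient (fun x => m⁻¹ * (η x * (m - φ x))) x‖ₑ ^ p := by
        gcongr
    _ = ∫⁻ x in U, ‖m‖ₑ ^ p * ‖gradient (fun x => m⁻¹ * (η x * (m - φ x))) x‖ₑ ^ p := by
        rw [lintegral_const_mul' _ _ (by finiteness)]
    _ = _ := by
        refine lintegral_congr fun x => ?_
        rw [enorm_gradient, fderiv_const_mul (hχ.differentiable (by simp) x), enorm_smul,
          ← ENNReal.mul_rpow_of_nonneg _ _ hp.le, ← mul_assoc, hmul, one_mul]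

/-- Maz'ya's capacitary Poincaré inequality on a ball. -/
theorem exists_capacity_poincare {N : ℕ} {p κ : ℝ} (hp : 1 < p) (hκ : 0 < κ) :
    ∃ C : ℝ≥0∞, C ≠ ⊤ ∧ ∀ (y : Space N) (ρ : ℝ), 0 < ρ → ∀ (K : Set (Space N)),
      K ⊆ Metric.closedBall y ρ →
      ENNReal.ofReal (κ * ρ ^ ((N : ℝ) - p)) ≤ pCapacity p K (Metric.ball y (2 * ρ)) →
      ∀ φ : Space N → ℝ, ContDiff ℝ ∞ φ → (∀ x ∈ K, φ x = 0) →
        ∫⁻ x in Metric.ball y (2 * ρ), ‖φ x‖ₑ ^ p ≤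
          C * ENNReal.ofReal ρ ^ p * ∫⁻ x in Metric.ball y (2 * ρ), ‖fderiv ℝ φ x‖ₑ ^ p := by
  obtain ⟨L, hL⟩ := exists_cutoff N
  have hp0 : 0 < p := by linarith
  obtain ⟨A, hA⟩ : ∃ A : ℝ≥0∞, A = 2 ^ N * 4 ^ p := ⟨_, rfl⟩
  obtain ⟨T, hT⟩ : ∃ T : ℝ≥0∞, T = 2 ^ (p - 1) * (ENNReal.ofReal L ^ p * A + 1) := ⟨_, rfl⟩
  obtain ⟨V, hV⟩ : ∃ V : ℝ≥0∞, V = volume (Metric.ball (0 : Space N) 1) := ⟨_, rfl⟩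
  obtain ⟨k, hk⟩ : ∃ k : ℝ≥0∞, k = ENNReal.ofReal κ := ⟨_, rfl⟩
  have hk0 : k ≠ 0 := by simp [hk, hκ]
  have hkt : k ≠ ⊤ := by simp [hk]
  have hAt : A ≠ ⊤ := by rw [hA]; finiteness
  have hTt : T ≠ ⊤ := by rw [hT]; finiteness
  have hVt : V ≠ ⊤ := by rw [hV]; exact measure_ball_lt_top.ne
  -- From `φ = (φ - m) + m`: `A` comes from the Poincaré inequality for `φ - m`, and `k⁻¹ * T` from
  -- the capacity bound on `ρ^{N-p}|m|^p`; `V * 2 ^ N` comes from the volume of the ball of radius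
  -- `2ρ`.
  refine ⟨2 ^ (p - 1) * (A + V * 2 ^ N * (k⁻¹ * T)), by finiteness, ?_⟩
  intro y ρ hρ K hK hcap φ hφ hφK
  obtain ⟨η, hη, hηc, hηs, hη1, hηb, hηd⟩ := hL y ρ hρ
  have hφ1 : ContDiff ℝ 1 φ := hφ.of_le (by simp)
  obtain ⟨m, hm⟩ := exists_lintegral_enorm_sub_rpow_le hp.le hφ1 y (R := 2 * ρ) (by linarith)
  obtain ⟨P, hP⟩ : ∃ P : ℝ≥0∞, P = ENNReal.ofReal ρ := ⟨_, rfl⟩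
  have hP0 : P ≠ 0 := by simp [hP, hρ]
  have hPt : P ≠ ⊤ := by simp [hP]
  obtain ⟨I, hI⟩ : ∃ I : ℝ≥0∞, I = ∫⁻ x in Metric.ball y (2 * ρ), ‖fderiv ℝ φ x‖ₑ ^ p :=
    ⟨_, rfl⟩
  have e4 : ENNReal.ofReal (2 * (2 * ρ)) = 4 * P := by
    rw [hP, ← mul_assoc, ENNReal.ofReal_mul (by norm_num)]
    norm_num
  rw [← hI, e4, ENNReal.mul_rpow_of_nonneg _ _ hp0.le, ← mul_assoc, ← hA] at hm
  rw [← hI, ← hP]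
  have hmb : P ^ ((N : ℝ) - p) * ‖m‖ₑ ^ p ≤ k⁻¹ * (T * I) := by
    have h1 := (enorm_rpow_mul_pCapacity_le hp0 hφ hη hηc hηs (fun x hx => hη1 x (hK hx)) hφK
      m).trans (lintegral_cutoff_le hp.le hφ1 (hη.of_le (by simp)) hηb hηd m _)
    have h2 : ‖m‖ₑ ^ p * (k * P ^ ((N : ℝ) - p)) ≤ T * I := by
      calc _ ≤ ‖m‖ₑ ^ p * pCapacity p K (Metric.ball y (2 * ρ)) := by
            refine mul_le_mul_right ?_ _
            rw [hk, hP, ENNReal.ofReal_rpow_of_pos hρ, ← ENNReal.ofReal_mul hκ.le]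
            exact hcap
        _ ≤ _ := h1
        _ ≤ 2 ^ (p - 1) * (ENNReal.ofReal (L / ρ) ^ p * (A * P ^ p * I) + I) := by
            rw [← hI]
            gcongr
        _ = 2 ^ (p - 1) * ((ENNReal.ofReal (L / ρ) * P) ^ p * A * I + I) := by
            rw [ENNReal.mul_rpow_of_nonneg _ _ hp0.le]
            ring
        _ = T * I := by
            rw [hP, ← ENNReal.ofReal_mul' hρ.le, div_mul_cancel₀ _ hρ.ne', hT]
            ring
    calc P ^ ((N : ℝ) - p) * ‖m‖ₑ ^ p = k⁻¹ * (‖m‖ₑ ^ p * (k * P ^ ((N : ℝ) - p))) := by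
          rw [show k⁻¹ * (‖m‖ₑ ^ p * (k * P ^ ((N : ℝ) - p))) =
            k⁻¹ * k * (P ^ ((N : ℝ) - p) * ‖m‖ₑ ^ p) by ring, ENNReal.inv_mul_cancel hk0 hkt,
            one_mul]
      _ ≤ _ := by gcongr
  have hvol : volume (Metric.ball y (2 * ρ)) = V * 2 ^ N * (P ^ p * P ^ ((N : ℝ) - p)) := by
    rw [Measure.addHaar_ball_of_pos _ _ (by positivity), ← ENNReal.rpow_add _ _ hP0 hPt, ← hV]
    simp only [finrank_euclideanSpace, Fintype.card_fin, add_sub_cancel, ENNReal.rpow_natCast]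
    rw [ENNReal.ofReal_pow (by positivity), ENNReal.ofReal_mul (by norm_num), ← hP]
    simp only [ENNReal.ofReal_ofNat]
    ring
  calc ∫⁻ x in Metric.ball y (2 * ρ), ‖φ x‖ₑ ^ p
      ≤ ∫⁻ x in Metric.ball y (2 * ρ), 2 ^ (p - 1) * (‖φ x - m‖ₑ ^ p + ‖m‖ₑ ^ p) := by
        refine lintegral_mono fun x => ?_
        refine le_trans ?_ (ENNReal.rpow_add_le_mul_rpow_add_rpow _ _ hp.le)
        gcongr
        simpa using enorm_add_le (φ x - m) m
    _ = 2 ^ (p - 1) * ((∫⁻ x in Metric.ball y (2 * ρ), ‖φ x - m‖ₑ ^ p) +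
          ‖m‖ₑ ^ p * volume (Metric.ball y (2 * ρ))) := by
        rw [lintegral_const_mul' _ _ (by finiteness), lintegral_add_right _ measurable_const,
          setLIntegral_const]
    _ ≤ 2 ^ (p - 1) * (A * P ^ p * I + V * 2 ^ N * P ^ p * (k⁻¹ * (T * I))) := by
        rw [hvol, show ‖m‖ₑ ^ p * (V * 2 ^ N * (P ^ p * P ^ ((N : ℝ) - p))) =
          V * 2 ^ N * P ^ p * (P ^ ((N : ℝ) - p) * ‖m‖ₑ ^ p) by ring]
        gcongr
    _ = _ := by ring

/-! ### Poincaré inequality with the inner radius -/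

/-- By Tonelli, since `z` lies in `B(x, r)` exactly when `x` lies in `B(z, r)`. Averaging over all
centres replaces a covering with bounded overlap. -/
theorem lintegral_setLIntegral_ball {N : ℕ} {f : Space N → ℝ≥0∞} (hf : Measurable f) {r : ℝ}
    (hr : 0 < r) :
    ∫⁻ x : Space N, ∫⁻ z in Metric.ball x r, f z =
      ENNReal.ofReal r ^ N * volume (Metric.ball (0 : Space N) 1) * ∫⁻ z, f z := by
  have hS : MeasurableSet {q : Space N × Space N | dist q.2 q.1 < r} :=
    measurableSet_lt (by fun_prop) measurable_const
  have e : ∀ x : Space N, ∫⁻ z in Metric.ball x r, f z =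
      ∫⁻ z, {q : Space N × Space N | dist q.2 q.1 < r}.indicator (fun q => f q.2) (x, z) := by
    intro x
    rw [← lintegral_indicator measurableSet_ball]
    rfl
  simp_rw [e]
  have hI : Measurable ({q : Space N × Space N | dist q.2 q.1 < r}.indicator fun q => f q.2) :=
    (hf.comp measurable_snd).indicator hS
  rw [lintegral_lintegral_swap (f := fun x z =>
    {q : Space N × Space N | dist q.2 q.1 < r}.indicator (fun q => f q.2) (x, z)) hI.aemeasurable]
  have e2 : ∀ z : Space N, ∫⁻ x : Space N,
      {q : Space N × Space N | dist q.2 q.1 < r}.indicator (fun q => f q.2) (x, z) =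
      ENNReal.ofReal r ^ N * volume (Metric.ball (0 : Space N) 1) * f z := by
    intro z
    calc _ = ∫⁻ x, (Metric.ball z r).indicator (fun _ => f z) x := by
          refine lintegral_congr fun x => ?_
          simp only [Set.indicator, Set.mem_ofPred_eq, Metric.mem_ball, dist_comm z x]
      _ = _ := by
          rw [lintegral_indicator measurableSet_ball, setLIntegral_const,
            Measure.addHaar_ball_of_pos _ _ hr, finrank_euclideanSpace, Fintype.card_fin,
            ENNReal.ofReal_pow hr.le, mul_comm]
  simp_rw [e2]
  rw [lintegral_const_mul _ hf]

/-- The Poincaré inequality with the inner radius, when the complement is uniformly fat. -/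
theorem exists_poincare_innerRadius {N : ℕ} {p κ : ℝ} (hp : 1 < p) (hκ : 0 < κ) :
    ∃ C : ℝ≥0∞, C ≠ ⊤ ∧ ∀ Ω : Set (Space N), IsUniformlyFat p κ Ωᶜ → ∀ r : ℝ, 0 < r →
      innerRadius Ω ≤ ENNReal.ofReal r →
      ∀ φ : Space N → ℝ, ContDiff ℝ ∞ φ → (∀ x ∉ Ω, φ x = 0) →
        ∫⁻ x, ‖φ x‖ₑ ^ p ≤ C * ENNReal.ofReal r ^ p * ∫⁻ x, ‖fderiv ℝ φ x‖ₑ ^ p := by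
  obtain ⟨C, hC, h⟩ := exists_capacity_poincare (N := N) hp hκ
  have hp0 : 0 < p := by linarith
  -- `6 ^ N` is the volume ratio of balls of radii `6r` and `r`; `2 ^ p` comes from using the
  -- capacitary inequality with `ρ = 2r`.
  refine ⟨6 ^ N * (C * 2 ^ p), by finiteness, fun Ω hΩ r hr hin φ hφ hφ0 => ?_⟩
  have hloc : ∀ x : Space N, ∫⁻ z in Metric.ball x r, ‖φ z‖ₑ ^ p ≤
      C * ENNReal.ofReal (2 * r) ^ p *
        ∫⁻ z in Metric.ball x (6 * r), ‖fderiv ℝ φ z‖ₑ ^ p := by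
    intro x
    -- The factor `2` provides a strict inequality, so that the distance need not be attained. Then
    -- `B(x, r) ⊆ B(y, 4r) ⊆ B(x, 6r)`.
    obtain ⟨y, hy, hxy⟩ : ∃ y ∈ Ωᶜ, dist x y < 2 * r := by
      by_cases hx : x ∈ Ω
      · have h1 : Metric.infEDist x Ωᶜ < ENNReal.ofReal (2 * r) :=
          lt_of_le_of_lt ((le_iSup₂ (f := fun x _ => Metric.infEDist x Ωᶜ) x hx).trans hin)
            ((ENNReal.ofReal_lt_ofReal_iff (by linarith)).2 (by linarith))
        obtain ⟨y, hy, hxy⟩ := Metric.infEDist_lt_iff.1 h1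
        refine ⟨y, hy, ?_⟩
        rw [edist_dist] at hxy
        exact (ENNReal.ofReal_lt_ofReal_iff (by linarith)).1 hxy
      · exact ⟨x, hx, by simpa using hr⟩
    calc ∫⁻ z in Metric.ball x r, ‖φ z‖ₑ ^ p
        ≤ ∫⁻ z in Metric.ball y (2 * (2 * r)), ‖φ z‖ₑ ^ p :=
          lintegral_mono_set (Metric.ball_subset_ball' (by linarith))
      _ ≤ _ := h y (2 * r) (by linarith) _ Set.inter_subset_right (hΩ y hy (2 * r) (by linarith))
          φ hφ fun z hz => hφ0 z hz.1
      _ ≤ _ := mul_le_mul_right (lintegral_mono_set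
          (Metric.ball_subset_ball' (by rw [dist_comm]; linarith))) _
  have hf : Measurable fun z => ‖φ z‖ₑ ^ p := hφ.continuous.enorm.measurable.pow_const p
  have hg : Measurable fun z => ‖fderiv ℝ φ z‖ₑ ^ p :=
    (hφ.continuous_fderiv (by simp)).enorm.measurable.pow_const p
  have hint := lintegral_mono hloc (μ := volume)
  rw [lintegral_const_mul' _ _ (by finiteness), lintegral_setLIntegral_ball hf hr,
    lintegral_setLIntegral_ball hg (by linarith)] at hint
  have hu0 : ENNReal.ofReal r ^ N * volume (Metric.ball (0 : Space N) 1) ≠ 0 :=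
    mul_ne_zero (pow_ne_zero _ (by simpa using hr)) (Metric.measure_ball_pos _ _ one_pos).ne'
  have hut : ENNReal.ofReal r ^ N * volume (Metric.ball (0 : Space N) 1) ≠ ⊤ :=
    ENNReal.mul_ne_top (by finiteness) measure_ball_lt_top.ne
  rw [← ENNReal.mul_le_mul_iff_right hu0 hut]
  refine hint.trans_eq ?_
  rw [ENNReal.ofReal_mul (by norm_num), ENNReal.ofReal_mul (by norm_num),
    ENNReal.mul_rpow_of_nonneg _ _ hp0.le]
  simp only [ENNReal.ofReal_ofNat]
  ring

/-! ### Sobolev inequality, passage to `W₀^{1,p}`, interpolation -/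

theorem eLpNorm_ofReal_eq {α F : Type*} [MeasurableSpace α] [NormedAddCommGroup F] {p : ℝ}
    (hp : 0 < p) (f : α → F) (μ : Measure α) :
    eLpNorm f (ENNReal.ofReal p) μ = (∫⁻ x, ‖f x‖ₑ ^ p ∂μ) ^ (1 / p) := by
  rw [eLpNorm_eq_lintegral_rpow_enorm_toReal (by simpa using hp) (by simp),
    ENNReal.toReal_ofReal hp.le]

theorem eLpNorm_ofReal_rpow {α F : Type*} [MeasurableSpace α] [NormedAddCommGroup F] {p : ℝ}
    (hp : 0 < p) (f : α → F) (μ : Measure α) :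
    eLpNorm f (ENNReal.ofReal p) μ ^ p = ∫⁻ x, ‖f x‖ₑ ^ p ∂μ := by
  rw [eLpNorm_ofReal_eq hp, ← ENNReal.rpow_mul, one_div, inv_mul_cancel₀ hp.ne', ENNReal.rpow_one]

/-- The Sobolev inequality for compactly supported smooth functions. -/
theorem exists_sobolev {N : ℕ} {p : ℝ} (hp : 1 < p) (hpN : p < N) :
    ∃ S : ℝ≥0∞, S ≠ ⊤ ∧ ∀ φ : Space N → ℝ, ContDiff ℝ ∞ φ → HasCompactSupport φ →
      eLpNorm φ (ENNReal.ofReal (N * p / (N - p))) volume ≤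
        S * eLpNorm (fderiv ℝ φ) (ENNReal.ofReal p) volume := by
  have hp0 : 0 < p := by linarith
  have hN : (0 : ℝ) < N := by linarith
  have hNp : (0 : ℝ) < N - p := by linarith
  refine ⟨SNormLESNormFDerivOfEqConst ℝ (volume : Measure (Space N)) p.toNNReal,
    ENNReal.coe_ne_top, fun φ hφ hc => ?_⟩
  refine eLpNorm_le_eLpNorm_fderiv_of_eq volume (hφ.of_le (by simp)) hc
    (by simpa using hp.le) ?_ ?_
  · simpa using hN
  · rw [NNReal.coe_inv, Real.coe_toNNReal _ hp0.le, Real.coe_toNNReal _ (by positivity), finrank_euclideanSpace,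
      Fintype.card_fin]
    field_simp

theorem eLpNorm_fderiv_eq_eLpNorm_gradient {N : ℕ} {φ : Space N → ℝ} {Ω : Set (Space N)}
    (hφ : tsupport φ ⊆ Ω) (q : ℝ≥0∞) :
    eLpNorm (fderiv ℝ φ) q volume = eLpNorm (gradient φ) q (volume.restrict Ω) := by
  have hsup : Function.support (gradient φ) ⊆ Ω := by
    intro x hx
    refine hφ (tsupport_fderiv_subset ℝ (f := φ) (subset_tsupport _ fun h => hx ?_))
    rw [gradient, h, map_zero]
  rw [eLpNorm_restrict_eq_of_support_subset hsup]
  exact eLpNorm_congr_enorm_ae (Eventually.of_forall fun x => (enorm_gradient φ x).symm)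

/-- An `L^q`–gradient estimate for test functions passes to `W₀^{1,p}`. -/
theorem MemW10.eLpNorm_le {N : ℕ} {p : ℝ} (hp : 1 ≤ p) {Ω : Set (Space N)}
    {q S : ℝ≥0∞} (hS : S ≠ ⊤)
    (h : ∀ φ : Space N → ℝ, ContDiff ℝ ∞ φ → HasCompactSupport φ → tsupport φ ⊆ Ω →
      eLpNorm φ q volume ≤ S * eLpNorm (fderiv ℝ φ) (ENNReal.ofReal p) volume)
    {u : Space N → ℝ} {G : Space N → Space N} (hu : MemW10 p Ω u G) :
    eLpNorm u q (volume.restrict Ω) ≤ S * eLpNorm G (ENNReal.ofReal p) (volume.restrict Ω) := by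
  obtain ⟨hW, φ, hφ, hlim, hlimG⟩ := hu
  have hp1 : 1 ≤ ENNReal.ofReal p := by simpa using hp
  have hm : ∀ n, AEStronglyMeasurable (φ n) (volume.restrict Ω) := fun n =>
    (hφ n).1.continuous.aestronglyMeasurable
  -- An almost everywhere convergent subsequence makes Fatou available for the `L^q` norm, so no
  -- convergence in `L^q` is needed.
  obtain ⟨ns, hns, hae⟩ := (tendstoInMeasure_of_tendsto_eLpNorm
    (zero_lt_one.trans_le hp1).ne' hm hW.memLp.1 hlim).exists_seq_tendsto_ae
  refine (Lp.eLpNorm_lim_le_liminf_eLpNorm (fun n => hm (ns n)) u hae).trans ?_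
  have hb : ∀ n, eLpNorm (φ (ns n)) q (volume.restrict Ω) ≤
      S * (eLpNorm (fun x => gradient (φ (ns n)) x - G x) (ENNReal.ofReal p)
        (volume.restrict Ω) + eLpNorm G (ENNReal.ofReal p) (volume.restrict Ω)) := by
    intro n
    obtain ⟨h1, h2, h3⟩ := hφ (ns n)
    refine (eLpNorm_mono_measure _ Measure.restrict_le_self).trans ((h _ h1 h2 h3).trans ?_)
    gcongr
    have hgc : Continuous (gradient (φ (ns n))) :=
      (InnerProductSpace.toDual ℝ (Space N)).symm.continuous.comp (h1.continuous_fderiv (by simp))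
    rw [eLpNorm_fderiv_eq_eLpNorm_gradient h3]
    calc eLpNorm (gradient (φ (ns n))) (ENNReal.ofReal p) (volume.restrict Ω)
        = eLpNorm ((fun x => gradient (φ (ns n)) x - G x) + G) (ENNReal.ofReal p)
          (volume.restrict Ω) := by
          congr 1
          ext1 x
          simp
      _ ≤ _ := eLpNorm_add_le (hgc.aestronglyMeasurable.sub hW.memLp_grad.1) hW.memLp_grad.1 hp1
  refine (liminf_le_liminf (Eventually.of_forall hb)).trans ?_
  refine (Tendsto.liminf_eq ?_).le
  have := ENNReal.Tendsto.const_mul (((hlimG.comp hns.tendsto_atTop)).add_const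
    (eLpNorm G (ENNReal.ofReal p) (volume.restrict Ω))) (Or.inr hS)
  simpa using this

/-- Hölder's inequality combined with interpolation between `L^p` and `L^{Np/(N-p)}`. -/
theorem lintegral_mul_rpow_le_interpolation {α : Type*} [MeasurableSpace α] {μ : Measure α}
    {N p s : ℝ} (hp : 1 < p) (hpN : p < N) (hs : N / p < s) {w u : α → ℝ}
    (hw : AEStronglyMeasurable w μ) (hu : AEStronglyMeasurable u μ) :
    ∫⁻ x, ‖w x‖ₑ * ‖u x‖ₑ ^ p ∂μ ≤ eLpNorm w (ENNReal.ofReal s) μ *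
      (eLpNorm u (ENNReal.ofReal p) μ ^ ((s * p - N) / s) *
        eLpNorm u (ENNReal.ofReal (N * p / (N - p))) μ ^ (N / s)) := by
  have hp0 : 0 < p := by linarith
  have hN : 0 < N := by linarith
  have hNp : 0 < N - p := by linarith
  have hs0 : 0 < s := (by positivity : 0 < N / p).trans hs
  have hsp : 0 < s * p - N := by
    rw [div_lt_iff₀ hp0] at hs
    linarith
  have hw' := hw.enorm
  have hu' := hu.enorm
  -- Three-factor Hölder with weights summing to `1`. Since `(sp-N)/s + N/s = p`, the last two
  -- factors recombine to `|u|^p`; `s > N/p` makes the middle weight positive.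
  have h := ENNReal.lintegral_prod_norm_pow_le (μ := μ) (Finset.univ : Finset (Fin 3))
    (f := ![fun x => ‖w x‖ₑ ^ s, fun x => ‖u x‖ₑ ^ p, fun x => ‖u x‖ₑ ^ (N * p / (N - p))])
    (p := ![1 / s, (s * p - N) / (s * p), (N - p) / (s * p)])
    (by intro i _; fin_cases i <;> simp <;> fun_prop)
    (by
      simp only [Fin.sum_univ_three, Matrix.cons_val_zero, Matrix.cons_val_one, Matrix.cons_val]
      field_simp
      ring)
    (by intro i _; fin_cases i <;> simp <;> positivity)
  simp only [Fin.prod_univ_three, Matrix.cons_val_zero, Matrix.cons_val_one,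
    Matrix.cons_val, ← ENNReal.rpow_mul] at h
  have e1 : s * (1 / s) = 1 := by field_simp
  have e2 : p * ((s * p - N) / (s * p)) = (s * p - N) / s := by field_simp
  have e3 : N * p / (N - p) * ((N - p) / (s * p)) = N / s := by field_simp
  have e4 : (s * p - N) / s + N / s = p := by field_simp; ring
  rw [e1, e2, e3, ← eLpNorm_ofReal_rpow hs0, ← eLpNorm_ofReal_rpow hp0,
    ← eLpNorm_ofReal_rpow (by positivity), ← ENNReal.rpow_mul, ← ENNReal.rpow_mul,
    ← ENNReal.rpow_mul, e1, e2, e3, ENNReal.rpow_one, mul_assoc] at h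
  refine le_trans (lintegral_mono fun x => ?_) h
  rw [ENNReal.rpow_one, mul_assoc, ← ENNReal.rpow_add_of_nonneg _ _ (by positivity)
    (by positivity), e4]

/-! ### Lyapunov inequality -/

theorem innerRadius_pos {N : ℕ} {Ω : Set (Space N)} (hΩ : IsOpen Ω) (hne : Ω.Nonempty) :
    innerRadius Ω ≠ 0 := by
  obtain ⟨x, hx⟩ := hne
  intro h
  have h1 : Metric.infEDist x Ωᶜ ≤ 0 :=
    (le_iSup₂ (f := fun x _ => Metric.infEDist x Ωᶜ) x hx).trans h.le
  exact (Metric.mem_iff_infEDist_zero_of_closed hΩ.isClosed_compl).2 (le_antisymm h1 bot_le) hx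

/-- Testing the equation with the solution itself. -/
theorem IsDirichletSolution.exists_energy_le {N : ℕ} {p : ℝ} (hp : 1 < p) {Ω : Set (Space N)}
    {w u : Space N → ℝ} (h : IsDirichletSolution p Ω w u) :
    ∃ G, MemW10 p Ω u G ∧ eLpNorm G (ENNReal.ofReal p) (volume.restrict Ω) ^ p ≤
      ∫⁻ x in Ω, ‖w x‖ₑ * ‖u x‖ₑ ^ p := by
  obtain ⟨G, hG, heq⟩ := h
  have hp0 : 0 < p := by linarith
  -- At `a = 0` both sides vanish whatever value `0 ^ (p - 2)` takes, so `p < 2` needs no separate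
  -- treatment.
  have key : ∀ a : ℝ, 0 ≤ a → a ^ (p - 2) * a ^ 2 = a ^ p := by
    intro a ha
    rcases ha.eq_or_lt with rfl | ha
    · simp [hp0.ne']
    · rw [← Real.rpow_natCast a 2, ← Real.rpow_add ha]
      norm_num
  have hmain := heq u G hG
  simp_rw [real_inner_self_eq_norm_sq, key _ (norm_nonneg _)] at hmain
  have hint : Integrable (fun x => ‖G x‖ ^ p) (volume.restrict Ω) := by
    have := hG.1.memLp_grad.integrable_norm_rpow (by simpa using hp0) (by simp)
    rwa [ENNReal.toReal_ofReal hp0.le] at this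
  refine ⟨G, hG, ?_⟩
  rw [eLpNorm_ofReal_rpow hp0]
  calc ∫⁻ x in Ω, ‖G x‖ₑ ^ p = ∫⁻ x in Ω, ENNReal.ofReal (‖G x‖ ^ p) := by
        refine lintegral_congr fun x => ?_
        rw [← ENNReal.ofReal_rpow_of_nonneg (norm_nonneg _) hp0.le, ofReal_norm]
    _ = ENNReal.ofReal (∫ x in Ω, w x * |u x| ^ (p - 2) * u x * u x) := by
        rw [← hmain, ofReal_integral_eq_lintegral_ofReal hint
          (Eventually.of_forall fun x => by positivity)]
    _ ≤ ‖∫ x in Ω, w x * |u x| ^ (p - 2) * u x * u x‖ₑ := by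
        rw [← ofReal_norm]
        exact ENNReal.ofReal_le_ofReal (Real.le_norm_self _)
    _ ≤ ∫⁻ x in Ω, ‖w x * |u x| ^ (p - 2) * u x * u x‖ₑ := enorm_integral_le_lintegral_enorm _
    _ = _ := by
        refine lintegral_congr fun x => ?_
        rw [show w x * |u x| ^ (p - 2) * u x * u x = w x * |u x| ^ p by
          rw [← key _ (abs_nonneg (u x)), sq_abs]; ring, enorm_mul]
        congr 1
        rw [← ofReal_norm, ← ofReal_norm, ENNReal.ofReal_rpow_of_nonneg (norm_nonneg _) hp0.le,
          Real.norm_of_nonneg (by positivity), Real.norm_eq_abs]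

/-- The Lyapunov inequality with the inner radius, for domains with uniformly fat complement. -/
theorem exists_lyapunov {N : ℕ} {p κ : ℝ} (hp : 1 < p) (hpN : p < N) (hκ : 0 < κ) :
    ∃ C : ℝ, 0 < C ∧ ∀ Ω : Set (Space N), IsOpen Ω → Ω.Nonempty → IsUniformlyFat p κ Ωᶜ →
      ∀ s : ℝ, (N : ℝ) / p < s → ∀ w : Space N → ℝ,
        AEStronglyMeasurable w (volume.restrict Ω) →
        ∀ u : Space N → ℝ, IsDirichletSolution p Ω w u → ¬ (u =ᵐ[volume.restrict Ω] 0) →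
          ENNReal.ofReal C / innerRadius Ω ^ ((s * p - (N : ℝ)) / s) ≤
            eLpNorm w (ENNReal.ofReal s) (volume.restrict Ω) := by
  have hp0 : 0 < p := by linarith
  have hN : (0 : ℝ) < N := by linarith
  have hNp : (0 : ℝ) < N - p := by linarith
  obtain ⟨A, hA, hpoinc⟩ := exists_poincare_innerRadius (N := N) hp hκ
  obtain ⟨S, hS, hsob⟩ := exists_sobolev hp hpN
  -- One constant serves both inequalities; the `+ 1` makes it nonzero, so that `C = M^{-p}` is
  -- finite.
  obtain ⟨M, hM⟩ : ∃ M : ℝ≥0∞, M = max (A ^ (1 / p)) S + 1 := ⟨_, rfl⟩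
  have hMA : A ^ (1 / p) ≤ M := hM ▸ (le_max_left _ _).trans le_self_add
  have hMS : S ≤ M := hM ▸ (le_max_right _ _).trans le_self_add
  have hM0 : M ≠ 0 := by simp [hM]
  have hMt : M ≠ ⊤ := by
    rw [hM]
    exact ENNReal.add_ne_top.2 ⟨max_ne_top (by finiteness) hS, ENNReal.one_ne_top⟩
  have hMp0 : M ^ p ≠ 0 := by simp [hM0, hMt]
  have hMpt : M ^ p ≠ ⊤ := by finiteness
  refine ⟨((M ^ p)⁻¹).toReal, ENNReal.toReal_pos (by simpa using hMpt) (by simpa using hMp0), ?_⟩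
  intro Ω hΩ hne hfat s hs w hw u hu hu0
  rw [ENNReal.ofReal_toReal (by simpa using hMp0)]
  have hs0 : 0 < s := (by positivity : 0 < (N : ℝ) / p).trans hs
  have hsp : 0 < (s * p - N) / s := by
    rw [div_lt_iff₀ hp0] at hs
    exact div_pos (by linarith) hs0
  have hr0 := innerRadius_pos hΩ hne
  -- If the inner radius is infinite, the left side is `0`. This includes `Ω = ℝ^N`, where fatness
  -- is vacuous.
  rcases eq_or_ne (innerRadius Ω) ⊤ with hrt | hrt
  · rw [hrt, ENNReal.top_rpow_of_pos hsp, ENNReal.div_top]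
    exact bot_le
  obtain ⟨R, hR⟩ : ∃ R : ℝ≥0∞, R = innerRadius Ω := ⟨_, rfl⟩
  rw [← hR] at hr0 hrt ⊢
  obtain ⟨G, hG, hen⟩ := hu.exists_energy_le hp
  have hP : eLpNorm u (ENNReal.ofReal p) (volume.restrict Ω) ≤
      M * R * eLpNorm G (ENNReal.ofReal p) (volume.restrict Ω) := by
    refine hG.eLpNorm_le hp.le (by finiteness) fun φ hφ _ hφs => ?_
    have := hpoinc Ω hfat R.toReal (ENNReal.toReal_pos hr0 hrt)
      (by rw [ENNReal.ofReal_toReal hrt, hR]) φ hφ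
      fun x hx => image_eq_zero_of_notMem_tsupport fun h => hx (hφs h)
    rw [ENNReal.ofReal_toReal hrt] at this
    rw [eLpNorm_ofReal_eq hp0, eLpNorm_ofReal_eq hp0]
    calc _ ≤ (A * R ^ p * ∫⁻ x, ‖fderiv ℝ φ x‖ₑ ^ p) ^ (1 / p) := by gcongr
      _ = A ^ (1 / p) * R * (∫⁻ x, ‖fderiv ℝ φ x‖ₑ ^ p) ^ (1 / p) := by
        rw [ENNReal.mul_rpow_of_nonneg _ _ (by positivity),
          ENNReal.mul_rpow_of_nonneg _ _ (by positivity), ← ENNReal.rpow_mul,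
          mul_one_div_cancel hp0.ne', ENNReal.rpow_one]
      _ ≤ _ := by gcongr
  have hSo : eLpNorm u (ENNReal.ofReal (N * p / (N - p))) (volume.restrict Ω) ≤
      M * eLpNorm G (ENNReal.ofReal p) (volume.restrict Ω) :=
    hG.eLpNorm_le hp.le hMt fun φ hφ hφc _ => (hsob φ hφ hφc).trans (by gcongr)
  have hint := lintegral_mul_rpow_le_interpolation hp hpN hs hw hG.1.memLp.1
  obtain ⟨X, hX⟩ : ∃ X, X = eLpNorm G (ENNReal.ofReal p) (volume.restrict Ω) := ⟨_, rfl⟩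
  obtain ⟨W, hW⟩ : ∃ W, W = eLpNorm w (ENNReal.ofReal s) (volume.restrict Ω) := ⟨_, rfl⟩
  rw [← hX] at hen hP hSo
  rw [← hW] at hint ⊢
  have hXt : X ≠ ⊤ := hX ▸ hG.1.memLp_grad.2.ne
  -- If the gradient vanished, the Sobolev inequality would force `u = 0` almost everywhere.
  have hX0 : X ≠ 0 := by
    rintro rfl
    rw [mul_zero, nonpos_iff_eq_zero, eLpNorm_eq_zero_iff hG.1.memLp.1
      (by simpa using (by positivity : (0 : ℝ) < N * p / (N - p)))] at hSo
    exact hu0 hSo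
  have e4 : (s * p - N) / s + N / s = p := by field_simp; ring
  have hNs : 0 < (N : ℝ) / s := by positivity
  have hfin : X ^ p ≤ W * (M ^ p * R ^ ((s * p - N) / s)) * X ^ p := by
    calc X ^ p ≤ _ := hen.trans hint
      _ ≤ W * ((M * R * X) ^ ((s * p - N) / s) * (M * X) ^ ((N : ℝ) / s)) := by gcongr
      _ = W * ((M ^ ((s * p - N) / s) * M ^ ((N : ℝ) / s)) * R ^ ((s * p - N) / s) *
          (X ^ ((s * p - N) / s) * X ^ ((N : ℝ) / s))) := by
        rw [ENNReal.mul_rpow_of_nonneg _ _ hsp.le, ENNReal.mul_rpow_of_nonneg _ _ hsp.le,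
          ENNReal.mul_rpow_of_nonneg _ _ hNs.le]
        ring
      _ = _ := by
        rw [← ENNReal.rpow_add_of_nonneg _ _ hsp.le hNs.le,
          ← ENNReal.rpow_add_of_nonneg _ _ hsp.le hNs.le, e4]
        ring
  have hXp0 : X ^ p ≠ 0 := by simp [hX0, hXt]
  have hXpt : X ^ p ≠ ⊤ := by finiteness
  have hone : 1 ≤ W * (M ^ p * R ^ ((s * p - N) / s)) := by
    rw [← ENNReal.mul_le_mul_iff_left hXp0 hXpt, one_mul]
    exact hfin
  have hRp0 : R ^ ((s * p - N) / s) ≠ 0 := by simp [hr0, hrt]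
  have hRpt : R ^ ((s * p - N) / s) ≠ ⊤ := by finiteness
  rw [ENNReal.div_le_iff hRp0 hRpt, ← one_div, ENNReal.div_le_iff hMp0 hMpt]
  refine hone.trans_eq ?_
  ring

/-! ### Capacity density from interior balls -/

/-- A lower bound for the capacity in terms of the volume. -/
theorem exists_volume_rpow_le_pCapacity {N : ℕ} {p : ℝ} (hp : 1 < p) (hpN : p < N) :
    ∃ S : ℝ≥0∞, S ≠ 0 ∧ S ≠ ⊤ ∧ ∀ K U : Set (Space N),
      volume K ^ (((N : ℝ) - p) / N) ≤ S * pCapacity p K U := by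
  have hp0 : 0 < p := by linarith
  have hN : (0 : ℝ) < N := by linarith
  have hNp : (0 : ℝ) < N - p := by linarith
  obtain ⟨S, hS, hsob⟩ := exists_sobolev hp hpN
  have hS0 : (S + 1) ^ p ≠ 0 := by simp [hS]
  have hSt : (S + 1) ^ p ≠ ⊤ := by finiteness
  refine ⟨(S + 1) ^ p, hS0, hSt, fun K U => ?_⟩
  rw [← ENNReal.inv_mul_le_iff hS0 hSt]
  refine le_iInf₂ fun φ ⟨hφ, hφc, hφs, hφK⟩ => ?_
  rw [ENNReal.inv_mul_le_iff hS0 hSt]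
  have hq : 0 < N * p / (N - p) := by positivity
  have h1 : volume K ≤ ∫⁻ x, ‖φ x‖ₑ ^ (N * p / (N - p)) := by
    have hm : Measurable fun x => ‖φ x‖ₑ ^ (N * p / (N - p)) :=
      hφ.continuous.enorm.measurable.pow_const _
    calc volume K ≤ volume {x | 1 ≤ ‖φ x‖ₑ ^ (N * p / (N - p))} := by
          refine measure_mono fun x hx => ?_
          have : 1 ≤ ‖φ x‖ₑ := by
            rw [← ofReal_norm, ← ENNReal.ofReal_one]
            exact ENNReal.ofReal_le_ofReal ((hφK x hx).trans (Real.le_norm_self _))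
          exact ENNReal.one_le_rpow this hq
      _ = 1 * volume {x | 1 ≤ ‖φ x‖ₑ ^ (N * p / (N - p))} := (one_mul _).symm
      _ ≤ _ := mul_meas_ge_le_lintegral hm 1
  have h2 := hsob φ hφ hφc
  rw [eLpNorm_fderiv_eq_eLpNorm_gradient hφs] at h2
  calc volume K ^ (((N : ℝ) - p) / N)
      ≤ (∫⁻ x, ‖φ x‖ₑ ^ (N * p / (N - p))) ^ (((N : ℝ) - p) / N) := by gcongr
    _ = eLpNorm φ (ENNReal.ofReal (N * p / (N - p))) volume ^ p := by
        rw [eLpNorm_ofReal_eq hq, ← ENNReal.rpow_mul]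
        congr 1
        field_simp
    _ ≤ ((S + 1) * eLpNorm (gradient φ) (ENNReal.ofReal p) (volume.restrict U)) ^ p := by
        gcongr
        exact h2.trans (by gcongr; exact le_self_add)
    _ = _ := by rw [ENNReal.mul_rpow_of_nonneg _ _ hp0.le, eLpNorm_ofReal_rpow hp0]

/-- A set with the interior corkscrew condition at all scales is uniformly fat. -/
theorem exists_isUniformlyFat_of_corkscrew {N : ℕ} {p : ℝ} (hp : 1 < p) (hpN : p < N)
    {E : Set (Space N)} {a : ℝ} (ha : 0 < a)
    (h : ∀ x ∈ E, ∀ r : ℝ, 0 < r → ∃ c, Metric.ball c (a * r) ⊆ E ∩ Metric.closedBall x r) :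
    ∃ κ : ℝ, 0 < κ ∧ IsUniformlyFat p κ E := by
  have hN : (0 : ℝ) < N := by linarith
  have hNp : (0 : ℝ) < N - p := by linarith
  obtain ⟨S, hS0, hSt, hcap⟩ := exists_volume_rpow_le_pCapacity hp hpN
  -- Volume `a^N r^N |B_1|` raised to the power `(N-p)/N` scales as `r^{N-p}`; `T` is the remaining
  -- constant.
  obtain ⟨T, hT⟩ : ∃ T : ℝ≥0∞, T = S⁻¹ * (ENNReal.ofReal (a ^ N) *
    volume (Metric.ball (0 : Space N) 1)) ^ (((N : ℝ) - p) / N) := ⟨_, rfl⟩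
  have hV0 : ENNReal.ofReal (a ^ N) * volume (Metric.ball (0 : Space N) 1) ≠ 0 :=
    mul_ne_zero (by simpa using pow_pos ha N) (Metric.measure_ball_pos _ _ one_pos).ne'
  have hVt : ENNReal.ofReal (a ^ N) * volume (Metric.ball (0 : Space N) 1) ≠ ⊤ :=
    ENNReal.mul_ne_top (by finiteness) measure_ball_lt_top.ne
  have hT0 : T ≠ 0 := by
    rw [hT]
    exact mul_ne_zero (by simpa using hSt) (by simp [hV0, hVt])
  have hTt : T ≠ ⊤ := by
    rw [hT]
    finiteness
  refine ⟨T.toReal, ENNReal.toReal_pos hT0 hTt, fun x hx r hr => ?_⟩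
  obtain ⟨c, hc⟩ := h x hx r hr
  have hvol : ENNReal.ofReal (a ^ N) * volume (Metric.ball (0 : Space N) 1) *
      ENNReal.ofReal (r ^ N) ≤ volume (E ∩ Metric.closedBall x r) := by
    refine le_trans (le_of_eq ?_) (measure_mono hc)
    rw [Measure.addHaar_ball_of_pos volume c (by positivity : 0 < a * r), finrank_euclideanSpace, Fintype.card_fin,
      mul_pow, ENNReal.ofReal_mul (by positivity)]
    ring
  have hr' : ENNReal.ofReal (r ^ N) ^ (((N : ℝ) - p) / N) = ENNReal.ofReal (r ^ ((N : ℝ) - p)) := by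
    rw [ENNReal.ofReal_rpow_of_pos (by positivity), ← Real.rpow_natCast, ← Real.rpow_mul hr.le,
      mul_div_cancel₀ _ hN.ne']
  rw [ENNReal.ofReal_mul ENNReal.toReal_nonneg, ENNReal.ofReal_toReal hTt, hT, ← hr', mul_assoc,
    ← ENNReal.mul_rpow_of_nonneg _ _ (by positivity), ENNReal.inv_mul_le_iff hS0 hSt]
  exact le_trans (by gcongr) (hcap _ _)

/-! ### Interior balls in the complement of a bounded `C¹` domain -/

/-- The complement of a `C¹` domain contains balls near each boundary point. -/
theorem IsC1Domain.exists_local_corkscrew {N : ℕ} {Ω : Set (Space N)} (hΩ : IsC1Domain Ω)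
    {z : Space N} (hz : z ∈ frontier Ω) :
    ∃ δ > 0, ∀ x ∈ Metric.ball z δ, x ∉ Ω → ∀ r : ℝ, 0 < r → r < δ →
      ∃ c, Metric.ball c (r / 4) ⊆ Ωᶜ ∩ Metric.closedBall x r := by
  obtain ⟨U, ρ, hU, hzU, hρ, hd, hΩU⟩ := hΩ.boundary z hz
  have hstrict : HasStrictFDerivAt ρ (fderiv ℝ ρ z) z :=
    (hρ.contDiffAt (hU.mem_nhds hzU)).hasStrictFDerivAt (by norm_num)
  obtain ⟨g, hg⟩ : ∃ g, g = gradient ρ z := ⟨_, rfl⟩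
  have hgf : ∀ v, fderiv ℝ ρ z v = inner ℝ g v := fun v => by rw [hg, inner_gradient_left]
  have hg0 : 0 < ‖g‖ := by
    rw [norm_pos_iff]
    rintro rfl
    exact hd (ContinuousLinearMap.ext fun v => by simp [hgf])
  obtain ⟨s, hs, happ⟩ := hstrict.approximates_deriv_on_nhds
    (c := Real.toNNReal (‖g‖ / 3)) (Or.inr (Real.toNNReal_pos.2 (by positivity)))
  obtain ⟨ε, hε, hball⟩ := Metric.mem_nhds_iff.1 (inter_mem hs (hU.mem_nhds hzU))
  refine ⟨ε / 2, by positivity, fun x hx hxΩ r hr hrε => ?_⟩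
  -- The centre is moved by `r/2` along `∇ρ(z)`. For `|w| < r/4` the linear part grows by at least
  -- `|g|r/2 - |g|r/4`, and the error is at most `(|g|/3)(3r/4)`; these balance, so `ρ(y) ≥ ρ(x) ≥
  -- 0`.
  refine ⟨x + (r / 2 / ‖g‖) • g, fun y hy => ?_⟩
  obtain ⟨w, rfl⟩ : ∃ w, y = x + (r / 2 / ‖g‖) • g + w := ⟨y - (x + (r / 2 / ‖g‖) • g), by simp⟩
  have hw : ‖w‖ < r / 4 := by simpa [dist_eq_norm] using hy
  have hv : ‖(r / 2 / ‖g‖) • g + w‖ ≤ 3 * r / 4 := by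
    have h1 : ‖(r / 2 / ‖g‖) • g‖ = r / 2 := by
      rw [norm_smul, Real.norm_of_nonneg (by positivity), div_mul_cancel₀ _ hg0.ne']
    linarith [norm_add_le ((r / 2 / ‖g‖) • g) w]
  have hsub : x + (r / 2 / ‖g‖) • g + w - x = (r / 2 / ‖g‖) • g + w := by abel
  have hyx : dist (x + (r / 2 / ‖g‖) • g + w) x ≤ 3 * r / 4 := by rwa [dist_eq_norm, hsub]
  have hxz : dist x z < ε / 2 := hx
  have hxm := hball (Metric.mem_ball.2 (by linarith : dist x z < ε))
  have hym := hball (Metric.mem_ball.2 (by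
    linarith [dist_triangle (x + (r / 2 / ‖g‖) • g + w) x z] :
    dist (x + (r / 2 / ‖g‖) • g + w) z < ε))
  refine ⟨fun hyΩ => ?_, Metric.mem_closedBall.2 (by linarith)⟩
  have hρy : ρ (x + (r / 2 / ‖g‖) • g + w) < 0 := (hΩU.subset ⟨hyΩ, hym.2⟩).1
  have hρx : 0 ≤ ρ x := by
    by_contra! h
    exact hxΩ (hΩU.symm.subset ⟨h, hxm.2⟩).1
  have h1 := happ _ hym.1 _ hxm.1
  rw [Real.coe_toNNReal _ (by positivity), hsub, hgf, inner_add_right, inner_smul_right, real_inner_self_eq_norm_sq] at h1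
  have h2 : r / 2 / ‖g‖ * ‖g‖ ^ 2 = r / 2 * ‖g‖ := by field_simp
  have h3 : |inner ℝ g w| ≤ ‖g‖ * (r / 4) :=
    (abs_real_inner_le_norm g w).trans (by gcongr)
  have h4 : ‖g‖ / 3 * ‖(r / 2 / ‖g‖) • g + w‖ ≤ ‖g‖ / 3 * (3 * r / 4) := by gcongr
  have h5 := (abs_le.1 (h1.trans h4)).1
  rw [h2] at h5
  linarith [(abs_le.1 h3).1]

theorem IsC1Domain.exists_uniform_corkscrew {N : ℕ} {Ω : Set (Space N)} (hΩ : IsC1Domain Ω)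
    (hb : Bornology.IsBounded Ω) :
    ∃ δ > 0, ∀ x ∈ frontier Ω, ∀ r : ℝ, 0 < r → r < δ →
      ∃ c, Metric.ball c (r / 4) ⊆ Ωᶜ ∩ Metric.closedBall x r := by
  have hK : IsCompact (frontier Ω) :=
    hb.isCompact_closure.of_isClosed_subset isClosed_frontier frontier_subset_closure
  have hfΩ : ∀ x ∈ frontier Ω, x ∉ Ω := fun x hx hxΩ =>
    (hΩ.isOpen.frontier_eq ▸ hx).2 hxΩ
  -- The condition `x ∉ Ω` is carried along because the neighbourhoods in the compactness induction
  -- are full balls, which also contain points of `Ω`.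
  suffices ∃ δ > 0, ∀ x ∈ frontier Ω, x ∉ Ω → ∀ r : ℝ, 0 < r → r < δ →
      ∃ c, Metric.ball c (r / 4) ⊆ Ωᶜ ∩ Metric.closedBall x r by
    obtain ⟨δ, hδ, h⟩ := this
    exact ⟨δ, hδ, fun x hx => h x hx (hfΩ x hx)⟩
  refine hK.induction_on (p := fun S => ∃ δ > 0, ∀ x ∈ S, x ∉ Ω → ∀ r : ℝ, 0 < r → r < δ →
      ∃ c, Metric.ball c (r / 4) ⊆ Ωᶜ ∩ Metric.closedBall x r) ?_ ?_ ?_ ?_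
  · exact ⟨1, one_pos, fun x hx => absurd hx (Set.notMem_empty x)⟩
  · rintro S T hST ⟨δ, hδ, h⟩
    exact ⟨δ, hδ, fun x hx => h x (hST hx)⟩
  · rintro S T ⟨δ, hδ, h⟩ ⟨δ', hδ', h'⟩
    refine ⟨min δ δ', lt_min hδ hδ', ?_⟩
    rintro x (hx | hx) hxΩ r hr hrδ
    · exact h x hx hxΩ r hr (hrδ.trans_le (min_le_left _ _))
    · exact h' x hx hxΩ r hr (hrδ.trans_le (min_le_right _ _))
  · intro z hz
    obtain ⟨δ, hδ, h⟩ := hΩ.exists_local_corkscrew hz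
    exact ⟨Metric.ball z δ, mem_nhdsWithin_of_mem_nhds (Metric.ball_mem_nhds z hδ), δ, hδ, h⟩

/-- Outside a bounded set there are large balls at large scales. -/
theorem exists_large_corkscrew {N : ℕ} (hN : 0 < N) {Ω : Set (Space N)} {M : ℝ}
    (hM : Ω ⊆ Metric.closedBall 0 M) (x : Space N) {r : ℝ} (hr : 0 < r) (hrM : 4 * M ≤ r) :
    ∃ c, Metric.ball c (r / 8) ⊆ Ωᶜ ∩ Metric.closedBall x r := by
  -- Moving by `r/2` in a direction with `⟨x, e⟩ ≥ 0` reaches norm at least `r/2`; the ball of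
  -- radius `r/8` then stays beyond `3r/8 > r/4 ≥ M`.
  obtain ⟨e, he, hxe⟩ : ∃ e : Space N, ‖e‖ = 1 ∧ 0 ≤ inner ℝ x e := by
    have h1 : ‖EuclideanSpace.single (⟨0, hN⟩ : Fin N) (1 : ℝ)‖ = 1 := by simp
    rcases le_total 0 (inner ℝ x (EuclideanSpace.single (⟨0, hN⟩ : Fin N) (1 : ℝ))) with h | h
    · exact ⟨_, h1, h⟩
    · exact ⟨-EuclideanSpace.single (⟨0, hN⟩ : Fin N) (1 : ℝ), by rw [norm_neg, h1],
        by rw [inner_neg_right]; linarith⟩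
  have hc : r / 2 ≤ ‖x + (r / 2) • e‖ := by
    have h1 := real_inner_le_norm (x + (r / 2) • e) e
    rw [inner_add_left, inner_smul_left, real_inner_self_eq_norm_sq, he] at h1
    simp only [conj_trivial] at h1
    linarith
  refine ⟨x + (r / 2) • e, fun y hy => ⟨fun hyΩ => ?_, ?_⟩⟩
  · have h1 := hM hyΩ
    rw [mem_closedBall_zero_iff] at h1
    rw [mem_ball_iff_norm'] at hy
    have h2 := norm_sub_norm_le (x + (r / 2) • e) y
    linarith
  · have h1 : dist (x + (r / 2) • e) x = r / 2 := by
      rw [dist_eq_norm, add_sub_cancel_left, norm_smul, he, Real.norm_of_nonneg (by positivity),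
        mul_one]
    have h2 := dist_triangle y (x + (r / 2) • e) x
    rw [Metric.mem_ball] at hy
    rw [Metric.mem_closedBall]
    linarith

/-- The complement of a bounded `C¹` domain satisfies the interior corkscrew condition at all
scales. -/
theorem IsC1Domain.exists_corkscrew {N : ℕ} (hN : 0 < N) {Ω : Set (Space N)} (hΩ : IsC1Domain Ω)
    (hb : Bornology.IsBounded Ω) :
    ∃ a : ℝ, 0 < a ∧ ∀ x ∈ Ωᶜ, ∀ r : ℝ, 0 < r →
      ∃ c, Metric.ball c (a * r) ⊆ Ωᶜ ∩ Metric.closedBall x r := by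
  obtain ⟨δ, hδ, hfr⟩ := hΩ.exists_uniform_corkscrew hb
  obtain ⟨M, hM0, hM⟩ := hb.subset_closedBall_lt 0 0
  have hsmall : ∀ x ∈ Ωᶜ, ∀ r : ℝ, 0 < r → r < δ →
      ∃ c, Metric.ball c (r / 8) ⊆ Ωᶜ ∩ Metric.closedBall x r := by
    intro x hx r hr hrδ
    -- Either this ball misses `Ω`, or by connectedness it meets the boundary, and the boundary
    -- estimate applies there at scale `r/2`.
    by_cases hB : Metric.ball x (r / 2) ⊆ Ωᶜ
    · exact ⟨x, Set.subset_inter ((Metric.ball_subset_ball (by linarith)).trans hB)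
        ((Metric.ball_subset_ball (by linarith)).trans Metric.ball_subset_closedBall)⟩
    · obtain ⟨b, hbx, hbf⟩ : (Metric.ball x (r / 2) ∩ frontier Ω).Nonempty := by
        obtain ⟨y, hy, hyΩ⟩ := Set.not_subset.1 hB
        by_contra hne
        have hout : ∀ z ∈ Metric.ball x (r / 2), z ∉ Ω → z ∉ closure Ω := fun z hz hzΩ hzc =>
          hne ⟨z, hz, hΩ.isOpen.frontier_eq ▸ ⟨hzc, hzΩ⟩⟩
        have hxb : x ∈ Metric.ball x (r / 2) := Metric.mem_ball_self (by linarith)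
        obtain ⟨z, -, hz, hz'⟩ := (convex_ball x (r / 2)).isPreconnected Ω (closure Ω)ᶜ hΩ.isOpen
          isClosed_closure.isOpen_compl
          (fun z hz => (em (z ∈ Ω)).imp id (hout z hz))
          ⟨y, hy, not_not.1 hyΩ⟩ ⟨x, hxb, hout x hxb hx⟩
        exact hz' (subset_closure hz)
      obtain ⟨c, hc⟩ := hfr b hbf (r / 2) (by linarith) (by linarith)
      rw [show r / 2 / 4 = r / 8 by ring] at hc
      rw [Metric.mem_ball] at hbx
      exact ⟨c, hc.trans (Set.inter_subset_inter_right _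
        (Metric.closedBall_subset_closedBall' (by linarith)))⟩
  -- For intermediate scales `δ ≤ r < 4M` the ball found at scale `δ/2` is reused; its radius `δ/16`
  -- equals `δ/(64M) · 4M`.
  refine ⟨min (1 / 8) (δ / (64 * M)), by positivity, fun x hx r hr => ?_⟩
  have h8 : min (1 / 8) (δ / (64 * M)) * r ≤ r / 8 := by
    have := mul_le_mul_of_nonneg_right (min_le_left (1 / 8) (δ / (64 * M))) hr.le
    linarith
  rcases lt_or_ge r δ with hrδ | hrδ
  · obtain ⟨c, hc⟩ := hsmall x hx r hr hrδ
    exact ⟨c, (Metric.ball_subset_ball h8).trans hc⟩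
  rcases le_or_gt (4 * M) r with hrM | hrM
  · obtain ⟨c, hc⟩ := exists_large_corkscrew hN hM x hr hrM
    exact ⟨c, (Metric.ball_subset_ball h8).trans hc⟩
  · obtain ⟨c, hc⟩ := hsmall x hx (δ / 2) (by linarith) (by linarith)
    refine ⟨c, (Metric.ball_subset_ball ?_).trans (hc.trans (Set.inter_subset_inter_right _
        (Metric.closedBall_subset_closedBall (by linarith))))⟩
    calc min (1 / 8) (δ / (64 * M)) * r ≤ δ / (64 * M) * (4 * M) := by
          gcongr
          exact min_le_right _ _
      _ = δ / 2 / 8 := by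
          field_simp
          norm_num

end Lyapunov

theorem theorem2p4 (N : ℕ) (p : ℝ) (hp : 1 < p) (hpN : p < (N : ℝ)) :
    (∀ κ : ℝ, 0 < κ → ∃ C : ℝ, 0 < C ∧
      ∀ Ω : Set (Lyapunov.Space N), Lyapunov.IsC1Domain Ω → Lyapunov.IsUniformlyFat p κ Ωᶜ →
        ∀ s : ℝ, (N : ℝ) / p < s →
          ∀ w : Lyapunov.Space N → ℝ, MemLp w (ENNReal.ofReal s) (volume.restrict Ω) →
            ∀ u : Lyapunov.Space N → ℝ, Lyapunov.IsDirichletSolution p Ω w u →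
              ¬ (u =ᵐ[volume.restrict Ω] 0) →
                ENNReal.ofReal C / Lyapunov.innerRadius Ω ^ ((s * p - (N : ℝ)) / s) ≤
                  eLpNorm w (ENNReal.ofReal s) (volume.restrict Ω)) ∧
    (∀ Ω : Set (Lyapunov.Space N), Lyapunov.IsC1Domain Ω → Bornology.IsBounded Ω →
      ∃ κ : ℝ, 0 < κ ∧ Lyapunov.IsUniformlyFat p κ Ωᶜ) := by
  refine ⟨fun κ hκ => ?_, fun Ω hΩ hb => ?_⟩
  · obtain ⟨C, hC, h⟩ := Lyapunov.exists_lyapunov hp hpN hκ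
    exact ⟨C, hC, fun Ω hΩ hfat s hs w hw u hu hu0 =>
      h Ω hΩ.isOpen hΩ.isConnected.nonempty hfat s hs w hw.1 u hu hu0⟩
  · have hN : 0 < N := by
      have : (0 : ℝ) < N := by linarith
      exact_mod_cast this
    obtain ⟨a, ha, h⟩ := hΩ.exists_corkscrew hN hb
    exact Lyapunov.exists_isUniformlyFat_of_corkscrew hp hpN ha h
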